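/- Let $n\ge 1$ and let $\mathfrak S_n$ be the symmetric group of $\{1,\dots,n\}$, its elements written as words $\sigma=\sigma_1\cdots\sigma_n$ and multiplied as maps, right to left. Let - $\mathsf{inv}(\sigma)=\#\{(i,j): i<j,\ \sigma_i>\sigma_j\}$; - $\mathsf{rmin}(\sigma)$, $\mathsf{rmax}(\sigma)$ be the number of places $i$ with $\sigma_i<\sigma_j$ (resp. $\sigma_i>\sigma_j$) for all $j>i$, and $\mathsf{lmin}(\sigma)$, $\mathsf{lmax}(\sigma)$ the number of places $i$ with $\sigma_i<\sigma_j$ (resp. $\sigma_i>\sigma_j$) for all $j<i$; - $\mathsf{cyc}(\sigma)$ be the number of cycles of $\sigma$, fixed points included; - $\mathsf{lmic}_1(\sigma)=\#\{i: b_i=1\}$, where $b_i=\sigma^{-k_i}(i)$ and $k_i\ge 1$ is the smallest integer with $\sigma^{-k_i}(i)\le i$; - $\mathsf{sor}(\sigma)=\sum_{r=1}^k (j_r-i_r)$, where $\sigma=(i_1\,j_1)(i_2\,j_2)\cdots(i_k\,j_k)$ is the unique decomposition of $\sigma$ into transpositions with $i_r<j_r$ for all $r$ and $j_1<j_2<\cdots<j_k$;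 - $\mathsf{maj}(\sigma)=\sum_{i\in \mathrm{Des}(\sigma)} i$, where $\mathrm{Des}(\sigma)=\{i: 1\le i<n,\ \sigma_i>\sigma_{i+1}\}$; $\mathsf{imaj}(\sigma)=\mathsf{maj}(\sigma^{-1})$; $\mathsf{rmaj}(\sigma)=\mathsf{maj}(\sigma')$, where $\sigma'_i=n+1-\sigma_{n+1-i}$; $\mathsf{chg}(\sigma)=\sum_{i\in \mathrm{Des}(\sigma^{-1})}(n-i)$; and $\mathsf{cochg}(\sigma)=\sum_{1\le i\le n,\ i\notin \mathrm{Des}(\sigma^{-1})}(n-i)$. Write $\mathsf{inv}^*=\binom n2-\mathsf{inv}$ and $\mathsf{sor}^*=\binom n2-\mathsf{sor}$. Consider the following quadruples of statistics on $\mathfrak S_n$, in which a dash marks an omitted entry: 1. $(\mathsf{inv},\mathsf{rmin},\mathsf{lmin},\mathsf{lmax})$ 2. $(\mathsf{sor},\mathsf{cyc},\mathsf{lmic}_1,\mathsf{lmax})$ 3. $(\mathsf{inv},\mathsf{lmax},\mathsf{lmin},\mathsf{rmin})$ 4. $(\mathsf{inv},\mathsf{rmin},\mathsf{rmax},\mathsf{lmax})$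 5. $(\mathsf{inv},\mathsf{lmax},\mathsf{rmax},\mathsf{rmin})$ 6. $(\mathsf{inv}^*,\mathsf{lmin},\mathsf{rmin},\mathsf{rmax})$ 7. $(\mathsf{inv}^*,\mathsf{rmax},\mathsf{lmax},\mathsf{lmin})$ 8. $(\mathsf{inv}^*,\mathsf{rmax},\mathsf{rmin},\mathsf{lmin})$ 9. $(\mathsf{inv}^*,\mathsf{lmin},\mathsf{lmax},\mathsf{rmax})$ 10. $(\mathsf{sor},\mathsf{lmax},\mathsf{lmic}_1,\mathsf{cyc})$ 11. $(\mathsf{sor}^*,\mathsf{lmic}_1,\mathsf{cyc},-)$ 12. $(\mathsf{sor}^*,-,\mathsf{lmax},\mathsf{lmic}_1)$ 13. $(\mathsf{sor}^*,-,\mathsf{cyc},\mathsf{lmic}_1)$ 14. $(\mathsf{sor}^*,\mathsf{lmic}_1,\mathsf{lmax},-)$ 15. $(-,\mathsf{cyc},-,\mathsf{rmin})$ 16. $(-,\mathsf{rmin},-,\mathsf{cyc})$ 17. $(\mathsf{maj},\mathsf{rmin},\mathsf{rmax},-)$ 18. $(\mathsf{imaj},\mathsf{lmax},\mathsf{rmax},-)$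 19. $(\mathsf{rmaj},\mathsf{lmax},\mathsf{lmin},-)$ 20. $(\mathsf{chg},\mathsf{rmin},\mathsf{lmin},-)$ 21. $(\mathsf{cochg},\mathsf{lmin},\mathsf{rmin},-)$ Then these quadruples are jointly equidistributed over $\mathfrak S_n$: for any two of them, the entries in the positions that are omitted in neither have the same joint distribution over $\mathfrak S_n$ in both. Moreover, for each quadruple $(s_1,s_2,s_3,s_4)$, the generating function of its first three statistics is $$\sum_{\sigma\in\mathfrak S_n}q^{s_1(\sigma)}x^{s_2(\sigma)}y^{s_3(\sigma)}=xy\prod_{r=2}^n\bigl(x+[r]_q+yq^{r-1}-1-q^{r-1}\bigr),\qquad [r]_q=1+q+\cdots+q^{r-1},$$ an identity in $\mathbb Z[q,x,y]$; where one of $s_1,s_2,s_3$ is omitted, its factor is dropped on the left and the variable $q$, $x$ or $y$ belonging to it is set to $1$ on the right. -/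

import Mathlib

namespace PermStat

open Finset

/-- The type of (number-valued) statistics on `𝔖ₙ`. The symmetric group of `{1, …, n}` is modelled
by `Equiv.Perm (Fin n)`: the letter or place `k ∈ {1, …, n}` is the element of `Fin n` with value
`k - 1`, the word of `σ` is `σ 0, σ 1, …`, and multiplication is composition of maps. -/
abbrev Stat (n : ℕ) : Type := Equiv.Perm (Fin n) → ℕ

/-- The inversion number: the number of pairs of places `i < j` with `σ i > σ j`. -/
def inv {n : ℕ} : Stat n := fun σ => #{p : Fin n × Fin n | p.1 < p.2 ∧ σ p.2 < σ p.1}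

/-- The number of right-to-left minima. -/
def rmin {n : ℕ} : Stat n := fun σ => #{i : Fin n | ∀ j, i < j → σ i < σ j}

/-- The number of right-to-left maxima. -/
def rmax {n : ℕ} : Stat n := fun σ => #{i : Fin n | ∀ j, i < j → σ j < σ i}

/-- The number of left-to-right minima. -/
def lmin {n : ℕ} : Stat n := fun σ => #{i : Fin n | ∀ j, j < i → σ i < σ j}

/-- The number of left-to-right maxima. -/
def lmax {n : ℕ} : Stat n := fun σ => #{i : Fin n | ∀ j, j < i → σ j < σ i}

/-- The number of cycles in the cycle decomposition; fixed points count as cycles (they are not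
listed in `Equiv.Perm.cycleType`). -/
def cyc {n : ℕ} : Stat n := fun σ => Multiset.card σ.cycleType + #{i : Fin n | σ i = i}

theorem exists_bCode {n : ℕ} (σ : Equiv.Perm (Fin n)) (i : Fin n) :
    ∃ k : ℕ, 1 ≤ k ∧ (σ⁻¹ ^ k) i ≤ i :=
  ⟨orderOf σ⁻¹, orderOf_pos _, by simp [pow_orderOf_eq_one]⟩

/-- The `B`-code of `σ`: the entry at `i` is `σ⁻ᵏ(i)`, where `k ≥ 1` is smallest with
`σ⁻ᵏ(i) ≤ i`. -/
def bCode {n : ℕ} (σ : Equiv.Perm (Fin n)) (i : Fin n) : Fin n :=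
  (σ⁻¹ ^ Nat.find (exists_bCode σ i)) i

/-- The number of indices at which the `B`-code has the smallest possible entry (the letter `1`,
that is, the element `0` of `Fin n`). -/
def lmic₁ {n : ℕ} : Stat n := fun σ => #{i : Fin n | (bCode σ i : ℕ) = 0}

/-- `l = [(i₁, j₁), …, (iₖ, jₖ)]` with `iᵣ < jᵣ`, `j₁ < ⋯ < jₖ` and
`σ = (i₁ j₁) (i₂ j₂) ⋯ (iₖ jₖ)`. -/
structure IsSortingDecomposition {n : ℕ} (σ : Equiv.Perm (Fin n)) (l : List (Fin n × Fin n)) :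
    Prop where
  fst_lt_snd : ∀ p ∈ l, p.1 < p.2
  snd_increasing : l.Pairwise fun p p' => p.2 < p'.2
  prod_eq : (l.map fun p => Equiv.swap p.1 p.2).prod = σ

theorem prod_swap_fix {n : ℕ} (l : List (Fin n × Fin n)) (m : Fin n)
    (h1 : ∀ p ∈ l, p.1 < p.2) (h2 : ∀ p ∈ l, p.2 < m) :
    (l.map fun p => Equiv.swap p.1 p.2).prod m = m := by
  induction l with
  | nil => simp
  | cons p l ih =>
    have ha := h1 p (by simp)
    have hb := h2 p (by simp)
    rw [List.map_cons, List.prod_cons, Equiv.Perm.mul_apply,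
      ih (fun q hq => h1 q (by simp [hq])) (fun q hq => h2 q (by simp [hq]))]
    exact Equiv.swap_apply_of_ne_of_ne (ha.trans hb).ne' hb.ne'

theorem exists_sortingDecomposition_aux {n : ℕ} (k : ℕ) (σ : Equiv.Perm (Fin n))
    (hσ : ∀ i : Fin n, k ≤ i.val → σ i = i) :
    ∃ l, IsSortingDecomposition σ l ∧ ∀ p ∈ l, p.2.val < k := by
  induction k generalizing σ with
  | zero =>
    refine ⟨[], ⟨by simp, by simp, ?_⟩, by simp⟩
    ext i
    simp [hσ i (Nat.zero_le _)]
  | succ k ih =>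
    by_cases hk : k < n
    · obtain ⟨i, hi⟩ := σ.surjective ⟨k, hk⟩
      by_cases hik : i = ⟨k, hk⟩
      · obtain ⟨l, hl, hl'⟩ := ih σ (fun m hm => by
          rcases hm.eq_or_lt with h | h
          · have : m = ⟨k, hk⟩ := Fin.ext h.symm
            rw [this]; rw [hik] at hi; exact hi
          · exact hσ m h)
        exact ⟨l, hl, fun p hp => (hl' p hp).trans (Nat.lt_succ_self k)⟩
      · have hlt : i < ⟨k, hk⟩ := by
          by_contra hcon
          have h1 : k + 1 ≤ i.val := by
            have h2 : k ≤ i.val := not_lt.mp hcon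
            have h3 : i.val ≠ k := fun h => hik (Fin.ext h)
            omega
          rw [hσ i h1] at hi
          exact hik hi
        obtain ⟨l, hl, hl'⟩ := ih (σ * Equiv.swap i ⟨k, hk⟩) (fun m hm => by
          rcases hm.eq_or_lt with h | h
          · have : m = ⟨k, hk⟩ := Fin.ext h.symm
            rw [this, Equiv.Perm.mul_apply, Equiv.swap_apply_right, hi]
          · rw [Equiv.Perm.mul_apply, Equiv.swap_apply_of_ne_of_ne, hσ m h]
            · rintro rfl
              exact absurd (Fin.lt_def.mp hlt) (by simp; omega)
            · rintro rfl
              simp at h)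
        refine ⟨l ++ [(i, ⟨k, hk⟩)], ⟨?_, ?_, ?_⟩, ?_⟩
        · intro p hp
          rcases List.mem_append.mp hp with h | h
          · exact hl.fst_lt_snd p h
          · rw [List.mem_singleton.mp h]; exact hlt
        · rw [List.pairwise_append]
          refine ⟨hl.snd_increasing, by simp, fun p hp q hq => ?_⟩
          rw [List.mem_singleton.mp hq]
          exact hl' p hp
        · rw [List.map_append, List.prod_append, hl.prod_eq]
          simp [mul_assoc]
        · intro p hp
          rcases List.mem_append.mp hp with h | h
          · exact (hl' p h).trans (Nat.lt_succ_self k)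
          · rw [List.mem_singleton.mp h]; exact Nat.lt_succ_self k
    · obtain ⟨l, hl, hl'⟩ := ih σ (fun m hm => absurd (hm.trans_lt m.isLt) hk)
      exact ⟨l, hl, fun p hp => (hl' p hp).trans (Nat.lt_succ_self k)⟩

theorem sortingDecomposition_unique {n : ℕ} (l l' : List (Fin n × Fin n))
    (σ : Equiv.Perm (Fin n)) (h : IsSortingDecomposition σ l)
    (h' : IsSortingDecomposition σ l') : l = l' := by
  -- the last transposition `(i, j)` of a decomposition: `j` is the largest non-fixed point
  have key : ∀ (l : List (Fin n × Fin n)) (p : Fin n × Fin n) (σ : Equiv.Perm (Fin n)),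
      IsSortingDecomposition σ (l ++ [p]) →
      IsSortingDecomposition (σ * Equiv.swap p.1 p.2) l ∧ σ p.1 = p.2 ∧ p.1 < p.2 ∧
        ∀ m, p.2 < m → σ m = m := by
    intro l p σ h
    have hlt : p.1 < p.2 := h.fst_lt_snd p (by simp)
    have hl1 : ∀ q ∈ l, q.1 < q.2 := fun q hq => h.fst_lt_snd q (by simp [hq])
    have hpw := List.pairwise_append.mp h.snd_increasing
    have hl2 : ∀ q ∈ l, q.2 < p.2 := fun q hq => hpw.2.2 q hq p (by simp)
    have hprod : (l.map fun p => Equiv.swap p.1 p.2).prod * Equiv.swap p.1 p.2 = σ := by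
      rw [← h.prod_eq, List.map_append, List.prod_append]; simp
    refine ⟨⟨hl1, hpw.1, ?_⟩, ?_, hlt, ?_⟩
    · rw [← hprod]; simp [mul_assoc]
    · rw [← hprod, Equiv.Perm.mul_apply, Equiv.swap_apply_left]
      exact prod_swap_fix l _ hl1 hl2
    · intro m hm
      rw [← h.prod_eq]
      refine prod_swap_fix _ m h.fst_lt_snd ?_
      intro q hq
      rcases List.mem_append.mp hq with hq | hq
      · exact (hl2 q hq).trans hm
      · rw [List.mem_singleton.mp hq]; exact hm
  induction l using List.reverseRecOn generalizing l' σ with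
  | nil =>
    rcases List.eq_nil_or_concat' l' with rfl | ⟨k', p', rfl⟩
    · rfl
    · have hσ : σ = 1 := by rw [← h.prod_eq]; simp
      obtain ⟨-, h2, h3, -⟩ := key k' p' σ h'
      rw [hσ] at h2
      exact absurd h2 h3.ne
  | append_singleton k p ih =>
    obtain ⟨h1, h2, h3, h4⟩ := key k p σ h
    rcases List.eq_nil_or_concat' l' with rfl | ⟨k', p', rfl⟩
    · have hσ : σ = 1 := by rw [← h'.prod_eq]; simp
      rw [hσ] at h2
      exact absurd h2 h3.ne
    · obtain ⟨h1', h2', h3', h4'⟩ := key k' p' σ h'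
      have hmove : ∀ {a b : Fin n}, a < b → σ a = b → σ b ≠ b := by
        intro a b hab hs hb
        exact hab.ne (σ.injective (hs.trans hb.symm))
      have e2 : p.2 = p'.2 := by
        rcases lt_trichotomy p.2 p'.2 with hlt | heq | hlt
        · exact absurd (h4 _ hlt) (hmove h3' h2')
        · exact heq
        · exact absurd (h4' _ hlt) (hmove h3 h2)
      have e1 : p.1 = p'.1 := σ.injective (by rw [h2, h2', e2])
      have e : p = p' := Prod.ext e1 e2
      subst e
      rw [ih k' _ h1 h1']

theorem existsUnique_sortingDecomposition {n : ℕ} (σ : Equiv.Perm (Fin n)) :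
    ∃! l, IsSortingDecomposition σ l := by
  obtain ⟨l, hl, -⟩ := exists_sortingDecomposition_aux n σ
    (fun i hi => absurd i.isLt (not_lt.mpr hi))
  exact ⟨l, hl, fun l' hl' => sortingDecomposition_unique l' l σ hl' hl⟩

/-- The sorting index: the sum of `jᵣ - iᵣ` over the unique decomposition of `σ` as in
`IsSortingDecomposition`. -/
noncomputable def sor {n : ℕ} : Stat n := fun σ =>
  ((existsUnique_sortingDecomposition σ).choose.map fun p => (p.2 : ℕ) - (p.1 : ℕ)).sum

/-- The descent set; the element `i` of `Fin n` stands for the place `i + 1`. -/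
def desSet {n : ℕ} (σ : Equiv.Perm (Fin n)) : Finset (Fin n) :=
  {i : Fin n | ∃ h : (i : ℕ) + 1 < n, σ ⟨i + 1, h⟩ < σ i}

/-- The reverse of the word of `σ`. -/
def reverse {n : ℕ} (σ : Equiv.Perm (Fin n)) : Equiv.Perm (Fin n) := σ * Fin.revPerm

/-- The complement of the word of `σ`: each letter `k` is replaced by `n + 1 - k`. -/
def complement {n : ℕ} (σ : Equiv.Perm (Fin n)) : Equiv.Perm (Fin n) := Fin.revPerm * σ

/-- The major index. -/
def maj {n : ℕ} : Stat n := fun σ => ∑ i ∈ desSet σ, ((i : ℕ) + 1)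

/-- The inverse major index. -/
def imaj {n : ℕ} : Stat n := fun σ => maj σ⁻¹

/-- The reverse major index. -/
def rmaj {n : ℕ} : Stat n := fun σ => maj (reverse (complement σ))

/-- The charge. -/
def chg {n : ℕ} : Stat n := fun σ => ∑ i ∈ desSet σ⁻¹, (n - ((i : ℕ) + 1))

/-- The cocharge. -/
def cochg {n : ℕ} : Stat n := fun σ => ∑ i ∈ (desSet σ⁻¹)ᶜ, (n - ((i : ℕ) + 1))

/-- `C(n,2) - inv`. The subtraction is never truncated: `inv` counts some of the `C(n,2)` pairs
`i < j`. -/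
def coinv {n : ℕ} : Stat n := fun σ => n.choose 2 - inv σ

/-- `C(n,2) - sor`. The subtraction is never truncated: the `jᵣ` in the sorting decomposition are
distinct, so that `sor ≤ 0 + 1 + ⋯ + (n - 1)`. -/
noncomputable def cosor {n : ℕ} : Stat n := fun σ => n.choose 2 - sor σ

/-- A quadruple of statistics on `𝔖ₙ`; the value `none` marks an omitted entry. -/
abbrev Quadruple (n : ℕ) : Type := Fin 4 → Option (Stat n)

/-- The listed quadruples. -/
noncomputable def quadruple (n : ℕ) : Fin 21 → Quadruple n :=
  ![![some inv, some rmin, some lmin, some lmax],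
    ![some sor, some cyc, some lmic₁, some lmax],
    ![some inv, some lmax, some lmin, some rmin],
    ![some inv, some rmin, some rmax, some lmax],
    ![some inv, some lmax, some rmax, some rmin],
    ![some coinv, some lmin, some rmin, some rmax],
    ![some coinv, some rmax, some lmax, some lmin],
    ![some coinv, some rmax, some rmin, some lmin],
    ![some coinv, some lmin, some lmax, some rmax],
    ![some sor, some lmax, some lmic₁, some cyc],
    ![some cosor, some lmic₁, some cyc, none],
    ![some cosor, none, some lmax, some lmic₁],
    ![some cosor, none, some cyc, some lmic₁],
    ![some cosor, some lmic₁, some lmax, none],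
    ![none, some cyc, none, some rmin],
    ![none, some rmin, none, some cyc],
    ![some maj, some rmin, some rmax, none],
    ![some imaj, some lmax, some rmax, none],
    ![some rmaj, some lmax, some lmin, none],
    ![some chg, some rmin, some lmin, none],
    ![some cochg, some lmin, some rmin, none]]

/-- Joint equidistribution over `𝔖ₙ` of two quadruples, taken over the entries that are omitted in
neither: every assignment `v` of values to these entries is attained by equally many permutations
on both sides. -/
def JointlyEquidistributed {n : ℕ} (Q Q' : Quadruple n) : Prop :=
  ∀ v : Fin 4 → ℕ,
    Nat.card {σ : Equiv.Perm (Fin n) // ∀ i, ∀ s ∈ Q i, ∀ _s' ∈ Q' i, s σ = v i} =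
      Nat.card {σ : Equiv.Perm (Fin n) // ∀ i, ∀ _s ∈ Q i, ∀ s' ∈ Q' i, s' σ = v i}

/-- The factor `t ^ s(σ)` of the entry `s` with variable `t`; an omitted entry has no factor. -/
def weight {n : ℕ} {R : Type*} [CommRing R] (o : Option (Stat n)) (t : R)
    (σ : Equiv.Perm (Fin n)) : R :=
  o.elim 1 fun s => t ^ s σ

/-- The variable `t` of an entry, specialised to `1` if the entry is omitted. -/
def variableOf {n : ℕ} {R : Type*} [CommRing R] (o : Option (Stat n)) (t : R) : R :=
  o.elim 1 fun _ => t

/-- `Fₙ(q,x,y) = x y ∏_{r=2}^{n} (x + [r]_q + y q^{r-1} - 1 - q^{r-1})`. -/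
def F {R : Type*} [CommRing R] (n : ℕ) (q x y : R) : R :=
  x * y * ∏ r ∈ Finset.Icc 2 n,
    (x + ∑ i ∈ Finset.range r, q ^ i + y * q ^ (r - 1) - 1 - q ^ (r - 1))

/-- The generating function of the first three entries of a quadruple, in the polynomial ring
`ℤ[q, x, y]` with `q = X 0`, `x = X 1` and `y = X 2`. -/
noncomputable def genFun {n : ℕ} (Q : Quadruple n) : MvPolynomial (Fin 3) ℤ :=
  ∑ σ : Equiv.Perm (Fin n),
    weight (Q 0) (MvPolynomial.X 0) σ * weight (Q 1) (MvPolynomial.X 1) σ *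
      weight (Q 2) (MvPolynomial.X 2) σ

end PermStat

namespace PermStat

open Finset

variable {n : ℕ}

/-! Everything is compared with the one quadruple `(inv, rmin, lmin, lmax)`: for each listed
quadruple some bijection of the symmetric group carries these statistics to its non-omitted entries
(`Realizes`). Equidistribution of any two then follows by composing one bijection with the inverse
of another, and only a single generating function has to be computed.

The bijections are composites of five. Inversion, reversal and complementation act on the diagram of
a permutation and permute the record statistics. The fourth (`exists_equiv_sor`) takes `inv, rmin,
lmin, lmax` to `sor, cyc, lmic₁, lmax`. A permutation of `n + 1` letters is coded by one of `n`
letters and a place `i`, either by inserting the largest letter at place `i` or by multiplying with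
the transposition of `i` and the largest letter; under both codings the respective statistics grow
by the same amounts. The fifth (`exists_equiv_chg`) is the inverse of Foata's transformation, which
turns charge of the inverse into `inv` and preserves `lmax` and `lmin`; the statistics of
major-index type reduce to it by symmetry.

The same insertion of the largest letter yields the product formula (`sum_inv_rmin_lmin`): each
factor is the sum of the weights of all places for the new letter. -/

/-! ### Symmetries: reversal, complementation, inversion. -/

@[simp] theorem reverse_apply (σ : Equiv.Perm (Fin n)) (i : Fin n) :
    reverse σ i = σ i.rev := rfl

@[simp] theorem complement_apply (σ : Equiv.Perm (Fin n)) (i : Fin n) :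
    complement σ i = (σ i).rev := rfl

theorem forall_fin_rev {p : Fin n → Prop} : (∀ i, p i) ↔ ∀ i : Fin n, p i.rev :=
  ⟨fun h i => h _, fun h i => by simpa using h i.rev⟩

theorem reverse_reverse (σ : Equiv.Perm (Fin n)) : reverse (reverse σ) = σ := by
  ext i; simp

theorem complement_complement (σ : Equiv.Perm (Fin n)) : complement (complement σ) = σ := by
  ext i; simp

/-- Reversal of words as an equivalence. -/
def reverseEquiv : Equiv.Perm (Fin n) ≃ Equiv.Perm (Fin n) :=
  ⟨reverse, reverse, reverse_reverse, reverse_reverse⟩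

/-- Complementation of words as an equivalence. -/
def complementEquiv : Equiv.Perm (Fin n) ≃ Equiv.Perm (Fin n) :=
  ⟨complement, complement, complement_complement, complement_complement⟩

@[simp] theorem reverseEquiv_apply (σ : Equiv.Perm (Fin n)) : reverseEquiv σ = reverse σ := rfl

@[simp] theorem complementEquiv_apply (σ : Equiv.Perm (Fin n)) :
    complementEquiv σ = complement σ := rfl

@[simp] theorem lmin_reverse (σ : Equiv.Perm (Fin n)) : lmin (reverse σ) = rmin σ := by
  unfold lmin rmin
  refine Finset.card_equiv Fin.revPerm fun i => ?_
  rw [mem_filter_univ, mem_filter_univ]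
  simp only [reverse_apply, Fin.revPerm_apply]
  rw [forall_fin_rev]; simp [Fin.rev_lt_iff]

@[simp] theorem rmin_reverse (σ : Equiv.Perm (Fin n)) : rmin (reverse σ) = lmin σ := by
  rw [← lmin_reverse, reverse_reverse]

@[simp] theorem lmax_reverse (σ : Equiv.Perm (Fin n)) : lmax (reverse σ) = rmax σ := by
  unfold lmax rmax
  refine Finset.card_equiv Fin.revPerm fun i => ?_
  rw [mem_filter_univ, mem_filter_univ]
  simp only [reverse_apply, Fin.revPerm_apply]
  rw [forall_fin_rev]; simp [Fin.rev_lt_iff]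

@[simp] theorem rmax_reverse (σ : Equiv.Perm (Fin n)) : rmax (reverse σ) = lmax σ := by
  rw [← lmax_reverse, reverse_reverse]

@[simp] theorem lmin_complement (σ : Equiv.Perm (Fin n)) : lmin (complement σ) = lmax σ := by
  simp [lmin, lmax]

@[simp] theorem lmax_complement (σ : Equiv.Perm (Fin n)) : lmax (complement σ) = lmin σ := by
  simp [lmin, lmax]

@[simp] theorem rmin_complement (σ : Equiv.Perm (Fin n)) : rmin (complement σ) = rmax σ := by
  simp [rmin, rmax]

@[simp] theorem rmax_complement (σ : Equiv.Perm (Fin n)) : rmax (complement σ) = rmin σ := by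
  simp [rmin, rmax]

theorem forall_perm {p : Fin n → Prop} (σ : Equiv.Perm (Fin n)) :
    (∀ i, p i) ↔ ∀ i : Fin n, p (σ i) :=
  ⟨fun h i => h _, fun h i => by simpa using h (σ⁻¹ i)⟩

/-- Contraposition; injectivity makes the weak inequalities strict unless `a = b`. With `τ = 1` it
exchanges the roles of places and letters in the definition of a record. -/
theorem lt_imp_lt_iff (σ τ : Equiv.Perm (Fin n)) (a b : Fin n) :
    (σ b < σ a → τ a < τ b) ↔ (τ b < τ a → σ a < σ b) := by
  have h1 := σ.injective.eq_iff (a := a) (b := b)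
  have h2 := τ.injective.eq_iff (a := a) (b := b)
  constructor <;> intro h h' <;> by_contra hcon
  · have : σ a ≠ σ b := fun e => by
      rw [h1] at e; exact absurd h' (by simp [e])
    exact absurd (h (lt_of_le_of_ne (not_lt.1 hcon) this.symm)) h'.not_gt
  · have : τ a ≠ τ b := fun e => by
      rw [h2] at e; exact absurd h' (by simp [e])
    exact absurd (h (lt_of_le_of_ne (not_lt.1 hcon) this.symm)) h'.not_gt

-- A left-to-right minimum is a point of the diagram with no point to its lower left, a condition
-- symmetric under transposition of the diagram. For `rmax` the quadrant is the upper right; the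
-- other two quadrants are exchanged.
@[simp] theorem lmin_inv (σ : Equiv.Perm (Fin n)) : lmin σ⁻¹ = lmin σ :=
  Finset.card_equiv σ⁻¹ fun i => by
    simp only [mem_filter_univ]
    rw [forall_perm σ]
    refine forall_congr' fun j => ?_
    simpa using lt_imp_lt_iff σ 1 (σ⁻¹ i) j

@[simp] theorem rmax_inv (σ : Equiv.Perm (Fin n)) : rmax σ⁻¹ = rmax σ :=
  Finset.card_equiv σ⁻¹ fun i => by
    simp only [mem_filter_univ]
    rw [forall_perm σ]
    refine forall_congr' fun j => ?_
    simpa using lt_imp_lt_iff σ 1 j (σ⁻¹ i)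

@[simp] theorem rmin_inv (σ : Equiv.Perm (Fin n)) : rmin σ⁻¹ = lmax σ :=
  Finset.card_equiv σ⁻¹ fun i => by
    simp only [mem_filter_univ]
    rw [forall_perm σ]
    refine forall_congr' fun j => ?_
    have := lt_imp_lt_iff (complement σ) 1 (σ⁻¹ i) j
    simpa using this

@[simp] theorem lmax_inv (σ : Equiv.Perm (Fin n)) : lmax σ⁻¹ = rmin σ := by
  rw [← rmin_inv, inv_inv]

@[simp] theorem inv_reverse_complement (σ : Equiv.Perm (Fin n)) :
    inv (reverse (complement σ)) = inv σ :=
  Finset.card_equiv ((Equiv.prodComm _ _).trans (Equiv.prodCongr Fin.revPerm Fin.revPerm))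
    fun p => by simp

@[simp] theorem inv_inv_perm (σ : Equiv.Perm (Fin n)) : inv σ⁻¹ = inv σ :=
  Finset.card_equiv ((Equiv.prodComm _ _).trans (Equiv.prodCongr σ⁻¹ σ⁻¹)) fun p => by
    simp [and_comm]

theorem card_lt_pairs (n : ℕ) : #{p : Fin n × Fin n | p.1 < p.2} = n.choose 2 := by
  have : #{p : Fin n × Fin n | p.1 < p.2} = ∑ b : Fin n, (b : ℕ) := by
    rw [Finset.card_filter, Fintype.sum_prod_type_right]
    refine Finset.sum_congr rfl fun b _ => ?_
    rw [← Finset.card_filter, ← Fin.card_Iio b]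
    congr 1
    ext a
    simp
  rw [this, Fin.sum_univ_eq_sum_range (fun i => i), Finset.sum_range_id, Nat.choose_two_right]

theorem inv_add_inv_complement (σ : Equiv.Perm (Fin n)) :
    inv σ + inv (complement σ) = n.choose 2 := by
  rw [← card_lt_pairs n, ← Finset.card_filter_add_card_filter_not (fun p => σ p.2 < σ p.1)]
  unfold inv
  congr 1
  · rw [Finset.filter_filter]
  · rw [Finset.filter_filter]
    congr 1
    ext p
    simp only [mem_filter_univ, complement_apply, Fin.rev_lt_rev, not_lt]
    refine and_congr_right fun h => ⟨le_of_lt, fun h' => lt_of_le_of_ne h' ?_⟩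
    exact fun e => h.ne (σ.injective e)

@[simp] theorem coinv_complement (σ : Equiv.Perm (Fin n)) : coinv (complement σ) = inv σ := by
  have := inv_add_inv_complement σ
  unfold coinv
  omega

@[simp] theorem coinv_reverse (σ : Equiv.Perm (Fin n)) : coinv (reverse σ) = inv σ := by
  have h := inv_reverse_complement (complement σ)
  rw [complement_complement] at h
  rw [← coinv_complement, coinv, coinv, h]

@[simp] theorem cyc_reverse_complement (σ : Equiv.Perm (Fin n)) :
    cyc (reverse (complement σ)) = cyc σ := by
  have h : reverse (complement σ) = Fin.revPerm * σ * Fin.revPerm⁻¹ := by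
    ext i; rfl
  unfold cyc
  congr 1
  · rw [h, Equiv.Perm.cycleType_conj]
  · refine Finset.card_equiv Fin.revPerm fun i => ?_
    simp [Fin.rev_eq_iff]

theorem chg_inv (σ : Equiv.Perm (Fin n)) :
    chg σ⁻¹ = ∑ i ∈ desSet σ, (n - ((i : ℕ) + 1)) := by
  simp [chg]

@[simp] theorem rmaj_eq_chg_inv (σ : Equiv.Perm (Fin n)) : rmaj σ = chg σ⁻¹ := by
  rw [chg_inv, rmaj, maj]
  -- Reverse-complementation moves a descent from place `p` to place `n - p`. The index `i` stands
  -- for place `i + 1`, hence the new index `n - 2 - i`.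
  have hb : ∀ (σ : Equiv.Perm (Fin n)) (i : Fin n), i ∈ desSet σ → n - 2 - (i : ℕ) < n := by
    intro σ i _; have := i.2; omega
  have key : ∀ (σ τ : Equiv.Perm (Fin n)), (∀ i, τ i = (σ i.rev).rev) →
      ∀ (i : Fin n) (hi : i ∈ desSet σ), (⟨n - 2 - (i : ℕ), hb σ i hi⟩ : Fin n) ∈ desSet τ := by
    intro σ τ hτ i hi
    simp only [desSet, mem_filter_univ] at hi ⊢
    obtain ⟨h, h'⟩ := hi
    refine ⟨show n - 2 - (i : ℕ) + 1 < n by omega, ?_⟩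
    rw [hτ, hτ, Fin.rev_lt_rev]
    convert h' using 2 <;> ext <;> simp [Fin.val_rev] <;> omega
  refine Finset.sum_bij' (fun i hi => ⟨n - 2 - (i : ℕ), hb _ i hi⟩)
    (fun i hi => ⟨n - 2 - (i : ℕ), hb _ i hi⟩) ?_ ?_ ?_ ?_ ?_
  · exact key _ _ (fun i => by simp)
  · exact key _ _ (fun i => by simp)
  all_goals
    intro i hi
    simp only [desSet, mem_filter_univ] at hi
    obtain ⟨h, -⟩ := hi
  · ext; simp; omega
  · ext; simp; omega
  · simp; omega

@[simp] theorem maj_reverse_complement (σ : Equiv.Perm (Fin n)) :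
    maj (reverse (complement σ)) = chg σ⁻¹ := by
  rw [← rmaj_eq_chg_inv]; rfl

-- Reversing `σ` complements `σ⁻¹`, which exchanges descents and ascents. The last place is never a
-- descent, but its weight is zero.
@[simp] theorem cochg_reverse (σ : Equiv.Perm (Fin n)) : cochg (reverse σ) = chg σ := by
  unfold cochg chg
  have e : (reverse σ)⁻¹ = complement σ⁻¹ := by
    ext i; rfl
  rw [e]
  symm
  refine Finset.sum_subset_zero_on_sdiff ?_ ?_ (fun _ _ => rfl)
  · intro i hi
    simp only [desSet, mem_filter_univ, mem_compl, complement_apply, Fin.rev_lt_rev] at hi ⊢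
    obtain ⟨h, h'⟩ := hi
    rintro ⟨_, h''⟩
    exact h'.not_gt h''
  · intro i hi
    simp only [desSet, mem_filter_univ, mem_compl, mem_sdiff, complement_apply,
      Fin.rev_lt_rev] at hi
    obtain ⟨h1, h2⟩ := hi
    have : ¬ (i : ℕ) + 1 < n := by
      intro h
      have hne : σ⁻¹ ⟨i + 1, h⟩ ≠ σ⁻¹ i := fun e => by
        have := congrArg Fin.val (σ⁻¹.injective e); simp at this
      rcases lt_or_gt_of_ne hne with h' | h'
      · exact h2 ⟨h, h'⟩
      · exact h1 ⟨h, h'⟩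
    omega

/-! ### Insertion of the largest letter and the product formula. -/

/-- The permutation of `Fin (n + 1)` whose word arises from that of `τ` by inserting the largest
letter at place `i`. -/
def insertLast (τ : Equiv.Perm (Fin n)) (i : Fin (n + 1)) : Equiv.Perm (Fin (n + 1)) :=
  ((finSuccEquiv' i).trans (Equiv.optionCongr τ)).trans (finSuccEquiv' (Fin.last n)).symm

@[simp] theorem insertLast_self (τ : Equiv.Perm (Fin n)) (i : Fin (n + 1)) :
    insertLast τ i i = Fin.last n := by
  simp [insertLast]

@[simp] theorem insertLast_succAbove (τ : Equiv.Perm (Fin n)) (i : Fin (n + 1)) (j : Fin n) :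
    insertLast τ i (i.succAbove j) = (τ j).castSucc := by
  simp [insertLast]

/-- The parameter `i` is recovered as the place of the largest letter; counting gives surjectivity.
-/
theorem bijective_of_apply_eq_last
    (f : Equiv.Perm (Fin n) → Fin (n + 1) → Equiv.Perm (Fin (n + 1)))
    (hlast : ∀ τ i, f τ i i = Fin.last n) (hinj : ∀ i, Function.Injective fun τ => f τ i) :
    Function.Bijective fun p : Equiv.Perm (Fin n) × Fin (n + 1) => f p.1 p.2 := by
  rw [Fintype.bijective_iff_injective_and_card]
  constructor
  · rintro ⟨τ, i⟩ ⟨τ', i'⟩ h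
    simp only at h
    obtain rfl : i = i' := by
      apply (f τ i).injective
      rw [hlast, h, hlast]
    rw [hinj i h]
  · simp [Fintype.card_perm, Nat.factorial_succ, mul_comm]

theorem insertLast_bijective :
    Function.Bijective fun p : Equiv.Perm (Fin n) × Fin (n + 1) => insertLast p.1 p.2 := by
  refine bijective_of_apply_eq_last _ insertLast_self fun i τ τ' h => ?_
  ext j
  have := congrArg (fun e : Equiv.Perm (Fin (n + 1)) => e (i.succAbove j)) h
  simpa [Fin.ext_iff] using this

/-- The new letter forms an inversion with exactly the `n - i` letters behind it. -/
theorem inv_insertLast (τ : Equiv.Perm (Fin n)) (i : Fin (n + 1)) :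
    inv (insertLast τ i) = inv τ + (n - i) := by
  unfold inv
  rw [Finset.card_filter, Finset.card_filter, Fintype.sum_prod_type, Fintype.sum_prod_type,
    Fin.sum_univ_succAbove _ i, Fin.sum_univ_succAbove _ i, add_comm]
  congr 1
  · refine Finset.sum_congr rfl fun a _ => ?_
    rw [Fin.sum_univ_succAbove _ i]
    simp [not_lt.2 (Fin.le_last _)]
  · simp only [lt_self_iff_false, false_and, if_false, insertLast_self, insertLast_succAbove,
      Fin.castSucc_lt_last, and_true, zero_add, Fin.lt_succAbove_iff_le_castSucc]
    have h : ∑ x : Fin n, (if i ≤ x.castSucc then 1 else 0)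
        = ∑ x ∈ Finset.range n, if (i : ℕ) ≤ x then 1 else 0 := by
      rw [← Fin.sum_univ_eq_sum_range]
      rfl
    rw [h, ← Finset.card_filter]
    have : {x ∈ Finset.range n | (i : ℕ) ≤ x} = Finset.Ico (i : ℕ) n := by
      ext x; simp [and_comm]
    rw [this, Nat.card_Ico]

/-- A largest letter destroys no minimum, and is one itself only when no letter follows it. -/
theorem rmin_insertLast (τ : Equiv.Perm (Fin n)) (i : Fin (n + 1)) :
    rmin (insertLast τ i) = rmin τ + if i = Fin.last n then 1 else 0 := by
  unfold rmin
  rw [Finset.card_filter, Finset.card_filter, Fin.sum_univ_succAbove _ i, add_comm]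
  congr 1
  · refine Finset.sum_congr rfl fun a _ => ?_
    simp [Fin.forall_iff_succAbove i]
  · congr 1
    simp only [insertLast_self, not_lt.2 (Fin.le_last _), imp_false, not_lt, eq_iff_iff]
    exact ⟨fun h => le_antisymm (Fin.le_last _) (h _), fun h j => h ▸ Fin.le_last j⟩

theorem lmin_insertLast (τ : Equiv.Perm (Fin n)) (i : Fin (n + 1)) :
    lmin (insertLast τ i) = lmin τ + if i = 0 then 1 else 0 := by
  unfold lmin
  rw [Finset.card_filter, Finset.card_filter, Fin.sum_univ_succAbove _ i, add_comm]
  congr 1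
  · refine Finset.sum_congr rfl fun a _ => ?_
    simp [Fin.forall_iff_succAbove i]
  · congr 1
    simp only [insertLast_self, not_lt.2 (Fin.le_last _), imp_false, not_lt, eq_iff_iff]
    exact ⟨fun h => le_antisymm (h _) (Fin.zero_le _), fun h j => h ▸ Fin.zero_le j⟩

/-- The last place contributes `x`, the first `y * q ^ (n + 1)`, and the inner ones plain powers of
`q`. At least two places are needed to keep the first and the last apart. -/
theorem sum_place_weights {R : Type*} [CommRing R] (n : ℕ) (q x y : R) :
    ∑ i : Fin (n + 2), q ^ (n + 1 - (i : ℕ)) * x ^ (if i = Fin.last (n + 1) then 1 else 0) *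
        y ^ (if i = 0 then 1 else 0) =
      x + ∑ i ∈ Finset.range (n + 2), q ^ i + y * q ^ (n + 1) - 1 - q ^ (n + 1) := by
  rw [Fin.sum_univ_succ, Fin.sum_univ_castSucc]
  have h : ∑ i : Fin n, q ^ (n + 1 - ((i.castSucc.succ : Fin (n + 2)) : ℕ)) *
      x ^ (if i.castSucc.succ = Fin.last (n + 1) then 1 else 0) *
        y ^ (if i.castSucc.succ = 0 then 1 else 0) = ∑ i ∈ Finset.range n, q ^ (i + 1) := by
    rw [← Finset.sum_range_reflect, ← Fin.sum_univ_eq_sum_range (fun i => q ^ (n - 1 - i + 1))]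
    refine Finset.sum_congr rfl fun i _ => ?_
    have h1 : i.castSucc.succ ≠ Fin.last (n + 1) := by
      simp [Fin.ext_iff]; omega
    have h2 : i.castSucc.succ ≠ 0 := Fin.succ_ne_zero _
    rw [if_neg h1, if_neg h2, pow_zero, pow_zero, mul_one, mul_one]
    congr 1
    simp; omega
  rw [h, Finset.sum_range_succ, Finset.sum_range_succ']
  have h1 : (0 : Fin (n + 2)) ≠ Fin.last (n + 1) := by simp [Fin.ext_iff]
  simp [h1]
  ring

/-- The generating function of `(inv, rmin, lmin)`. -/
theorem sum_inv_rmin_lmin {R : Type*} [CommRing R] (n : ℕ) (q x y : R) :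
    ∑ σ : Equiv.Perm (Fin (n + 1)), q ^ inv σ * x ^ rmin σ * y ^ lmin σ = F (n + 1) q x y := by
  have step : ∀ m : ℕ, ∑ σ : Equiv.Perm (Fin (m + 1)), q ^ inv σ * x ^ rmin σ * y ^ lmin σ =
      (∑ σ : Equiv.Perm (Fin m), q ^ inv σ * x ^ rmin σ * y ^ lmin σ) *
      ∑ i : Fin (m + 1), q ^ (m - (i : ℕ)) * x ^ (if i = Fin.last m then 1 else 0) *
        y ^ (if i = 0 then 1 else 0) := by
    intro m
    rw [← insertLast_bijective.sum_comp, Fintype.sum_prod_type, Finset.sum_mul_sum]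
    refine Finset.sum_congr rfl fun τ _ => Finset.sum_congr rfl fun i _ => ?_
    rw [inv_insertLast, rmin_insertLast, lmin_insertLast, pow_add, pow_add, pow_add]
    ring
  induction n with
  | zero =>
    -- For a single letter the only place is both first and last, which gives the initial factor `x
    -- * y`.
    rw [step]
    simp [F, inv, rmin, lmin]
  | succ n ih =>
    rw [step, ih, sum_place_weights, F, F, Finset.prod_Icc_succ_top (b := n + 1) (by omega)]
    rw [mul_assoc (x * y)]
    simp

/-! ### The `B`-code and its relation to cycles. -/

section FirstBelow

variable {α : Type*} [LinearOrder α]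

/-- `FirstBelow f a x b`: the first of the points `f x, f (f x), …` that is at most `a` is `b`. -/
inductive FirstBelow (f : α → α) (a : α) : α → α → Prop
  | done {x : α} : f x ≤ a → FirstBelow f a x (f x)
  | step {x b : α} : a < f x → FirstBelow f a (f x) b → FirstBelow f a x b

theorem FirstBelow.unique {f : α → α} {a x b b' : α} (h : FirstBelow f a x b)
    (h' : FirstBelow f a x b') : b = b' := by
  induction h with
  | done h1 =>
    cases h' with
    | done => rfl
    | step h2 _ => exact absurd h1 h2.not_ge
  | step h1 _ ih =>
    cases h' with
    | done h2 => exact absurd h2 h1.not_ge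
    | step _ h2 => exact ih h2

/-- Replaces the minimal exponent by an inductive description of the backward walk. Enlarging a
cycle changes the exponent, whereas induction along the walk needs no step count. -/
theorem firstBelow_bCode (σ : Equiv.Perm (Fin n)) (a : Fin n) :
    FirstBelow (⇑σ⁻¹) a a (bCode σ a) := by
  have key : ∀ (k : ℕ) (x : Fin n), (∀ m, 1 ≤ m → m ≤ k → a < (σ⁻¹ ^ m) x) →
      (σ⁻¹ ^ (k + 1)) x ≤ a → FirstBelow (⇑σ⁻¹) a x ((σ⁻¹ ^ (k + 1)) x) := by
    intro k
    induction k with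
    | zero =>
      intro x _ h
      rw [zero_add, pow_one] at h ⊢
      exact .done h
    | succ k ih =>
      intro x h1 h2
      have e : ∀ m, (σ⁻¹ ^ (m + 1)) x = (σ⁻¹ ^ m) (σ⁻¹ x) := fun m => by
        rw [pow_succ, Equiv.Perm.mul_apply]
      rw [e] at h2 ⊢
      refine .step (by simpa using h1 1 le_rfl (by omega)) (ih _ (fun m hm hm' => ?_) h2)
      rw [← e]
      exact h1 _ (by omega) (by omega)
  have h := Nat.find_spec (exists_bCode σ a)
  obtain ⟨k, hk⟩ := Nat.exists_eq_add_of_le' h.1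
  rw [bCode, hk]
  refine key k a (fun m hm hm' => ?_) (hk ▸ h.2)
  have := Nat.find_min (exists_bCode σ a) (m := m) (by omega)
  exact not_le.1 fun hle => this ⟨hm, hle⟩

theorem bCode_eq_of_firstBelow {σ : Equiv.Perm (Fin n)} {a b : Fin n}
    (h : FirstBelow (⇑σ⁻¹) a a b) : bCode σ a = b :=
  (firstBelow_bCode σ a).unique h

end FirstBelow

theorem exists_zpow_eq_bCode (σ : Equiv.Perm (Fin n)) (a : Fin n) :
    σ.SameCycle a (bCode σ a) :=
  ⟨-(Nat.find (exists_bCode σ a) : ℤ), by rw [zpow_neg, zpow_natCast, ← inv_pow]; rfl⟩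

theorem bCode_le (σ : Equiv.Perm (Fin n)) (a : Fin n) : bCode σ a ≤ a :=
  (Nat.find_spec (exists_bCode σ a)).2

/-- The `B`-code is fixed exactly at the minima of the cycles. -/
theorem bCode_eq_self_iff (σ : Equiv.Perm (Fin n)) (a : Fin n) :
    bCode σ a = a ↔ ∀ b, σ.SameCycle a b → a ≤ b := by
  constructor
  · intro h b hb
    obtain ⟨hk, -⟩ := Nat.find_spec (exists_bCode σ a)
    have hmin := fun m => Nat.find_min (exists_bCode σ a) (m := m)
    unfold bCode at h
    generalize Nat.find (exists_bCode σ a) = k at hk h hmin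
    obtain ⟨m, -, rfl⟩ := (Equiv.Perm.sameCycle_inv.2 hb).exists_pow_eq'
    -- The walk returns to `a` after `k` steps, so exponents matter only modulo `k`; by minimality
    -- of `k`, the points strictly in between lie above `a`.
    have : (σ⁻¹ ^ m) a = (σ⁻¹ ^ (m % k)) a := by
      conv_lhs => rw [← Nat.mod_add_div m k]
      rw [pow_add, Equiv.Perm.mul_apply, pow_mul]
      congr 1
      exact Equiv.Perm.pow_apply_eq_self_of_apply_eq_self h _
    rw [this]
    by_contra hlt
    have hmod : m % k < k := Nat.mod_lt _ hk
    refine hmin _ hmod ⟨?_, (not_le.1 hlt).le⟩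
    by_contra h0
    have h0 : m % k = 0 := by omega
    simp [h0] at hlt
  · exact fun h => le_antisymm (bCode_le σ a) (h _ (exists_zpow_eq_bCode σ a))

/-- Every cycle has exactly one minimum; fixed points are treated separately, as in `cyc`. -/
theorem cyc_eq_card_bCode (σ : Equiv.Perm (Fin n)) : cyc σ = #{a : Fin n | bCode σ a = a} := by
  rw [← Finset.card_filter_add_card_filter_not (fun a => σ a ≠ a), Finset.filter_filter,
    Finset.filter_filter]
  unfold cyc
  congr 1
  · rw [Equiv.Perm.cycleType_def, Multiset.card_map]
    symm
    refine Finset.card_bij (fun a _ => σ.cycleOf a) ?_ ?_ ?_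
    · intro a ha
      simp only [mem_filter_univ] at ha
      exact Equiv.Perm.cycleOf_mem_cycleFactorsFinset_iff.2 (by simpa using ha.2)
    · intro a ha b hb h
      simp only [mem_filter_univ, bCode_eq_self_iff] at ha hb
      have hab : σ.SameCycle a b := by
        have : b ∈ (σ.cycleOf b).support := by
          rw [Equiv.Perm.mem_support_cycleOf_iff]
          exact ⟨.refl _ _, by simpa using hb.2⟩
        rw [← h, Equiv.Perm.mem_support_cycleOf_iff] at this
        exact this.1
      exact le_antisymm (ha.1 b hab) (hb.1 a hab.symm)
    · intro c hc
      have hne : c.support.Nonempty :=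
        Equiv.Perm.IsCycle.nonempty_support (Equiv.Perm.mem_cycleFactorsFinset_iff.1 hc).1
      have hmem := c.support.min'_mem hne
      set a := c.support.min' hne with ha
      have hca : c = σ.cycleOf a := Equiv.Perm.cycle_is_cycleOf hmem hc
      have hσ : σ a ≠ a := by
        have := Equiv.Perm.mem_cycleFactorsFinset_support_le hc hmem
        simpa using this
      refine ⟨a, ?_, hca.symm⟩
      simp only [mem_filter_univ, bCode_eq_self_iff]
      refine ⟨fun b hb => ?_, hσ⟩
      rw [ha]
      refine Finset.min'_le _ _ ?_
      rw [hca, Equiv.Perm.mem_support_cycleOf_iff]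
      exact ⟨hb, by simpa using hσ⟩
  · congr 1
    ext a
    simp only [mem_filter_univ, ne_eq, not_not]
    refine ⟨fun h => ⟨?_, h⟩, fun h => h.2⟩
    rw [bCode_eq_self_iff]
    intro b hb
    exact ((hb.eq_of_left h)).le

/-! ### Multiplication by a transposition with the largest letter. -/

/-- The permutation of `Fin (n + 1)` that extends `τ` and fixes the largest letter, multiplied from
the right by the transposition of `i` and the largest letter. -/
def swapLast (τ : Equiv.Perm (Fin n)) (i : Fin (n + 1)) : Equiv.Perm (Fin (n + 1)) :=
  insertLast τ (Fin.last n) * Equiv.swap i (Fin.last n)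

@[simp] theorem insertLast_last_castSucc (τ : Equiv.Perm (Fin n)) (j : Fin n) :
    insertLast τ (Fin.last n) j.castSucc = (τ j).castSucc := by
  rw [← Fin.succAbove_last_apply, insertLast_succAbove]

@[simp] theorem swapLast_self (τ : Equiv.Perm (Fin n)) (i : Fin (n + 1)) :
    swapLast τ i i = Fin.last n := by
  simp [swapLast]

theorem swapLast_castSucc (τ : Equiv.Perm (Fin n)) {i : Fin (n + 1)} {j : Fin n}
    (h : j.castSucc ≠ i) : swapLast τ i j.castSucc = (τ j).castSucc := by
  rw [swapLast, Equiv.Perm.mul_apply, Equiv.swap_apply_of_ne_of_ne h (Fin.castSucc_ne_last j),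
    insertLast_last_castSucc]

theorem swapLast_bijective :
    Function.Bijective fun p : Equiv.Perm (Fin n) × Fin (n + 1) => swapLast p.1 p.2 := by
  refine bijective_of_apply_eq_last _ swapLast_self fun i τ τ' h => ?_
  have h' : insertLast τ (Fin.last n) = insertLast τ' (Fin.last n) := mul_right_cancel h
  have := insertLast_bijective.1 (a₁ := (τ, Fin.last n)) (a₂ := (τ', Fin.last n)) h'
  exact (Prod.ext_iff.1 this).1

theorem swapLast_inv_last (τ : Equiv.Perm (Fin n)) (i : Fin (n + 1)) :
    (swapLast τ i)⁻¹ (Fin.last n) = i := by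
  rw [Equiv.Perm.inv_eq_iff_eq, swapLast_self]

theorem swapLast_inv_castSucc (τ : Equiv.Perm (Fin n)) (i : Fin (n + 1)) (j : Fin n) :
    (swapLast τ i)⁻¹ j.castSucc =
      if (τ⁻¹ j).castSucc = i then Fin.last n else (τ⁻¹ j).castSucc := by
  rw [Equiv.Perm.inv_eq_iff_eq]
  split_ifs with h
  · rw [swapLast, Equiv.Perm.mul_apply, Equiv.swap_apply_right, ← h, insertLast_last_castSucc]
    simp
  · rw [swapLast_castSucc τ h]
    simp

theorem bCode_swapLast_last (τ : Equiv.Perm (Fin n)) (i : Fin (n + 1)) :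
    bCode (swapLast τ i) (Fin.last n) = i := by
  have h : FirstBelow (⇑(swapLast τ i)⁻¹) (Fin.last n) (Fin.last n) _ := .done (Fin.le_last _)
  rw [bCode_eq_of_firstBelow h, swapLast_inv_last]

/-- The largest letter is spliced into the cycle of `i` directly after `i`, or is a fixed point. A
backward walk from `a` that meets it does not stop there, since it exceeds `a`, and then continues
to `i` as before. -/
theorem bCode_swapLast_castSucc (τ : Equiv.Perm (Fin n)) (i : Fin (n + 1)) (a : Fin n) :
    bCode (swapLast τ i) a.castSucc = (bCode τ a).castSucc := by
  have key : ∀ {x b : Fin n}, FirstBelow (⇑τ⁻¹) a x b →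
      FirstBelow (⇑(swapLast τ i)⁻¹) a.castSucc x.castSucc b.castSucc := by
    intro x b h
    induction h with
    | @done x h =>
      by_cases hx : (τ⁻¹ x).castSucc = i
      · refine .step ?_ ?_
        · rw [swapLast_inv_castSucc, if_pos hx]
          exact Fin.castSucc_lt_last a
        · have e : (τ⁻¹ x).castSucc = (swapLast τ i)⁻¹ (Fin.last n) := by
            rw [swapLast_inv_last, hx]
          rw [swapLast_inv_castSucc, if_pos hx, e]
          exact .done (e ▸ h)
      · have e : (τ⁻¹ x).castSucc = (swapLast τ i)⁻¹ x.castSucc := by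
          rw [swapLast_inv_castSucc, if_neg hx]
        rw [e]
        exact .done (e ▸ h)
    | @step x b h _ ih =>
      by_cases hx : (τ⁻¹ x).castSucc = i
      · refine .step ?_ (.step ?_ ?_)
        · rw [swapLast_inv_castSucc, if_pos hx]
          exact Fin.castSucc_lt_last a
        · rw [swapLast_inv_castSucc, if_pos hx, swapLast_inv_last, ← hx]
          exact h
        · rw [swapLast_inv_castSucc, if_pos hx, swapLast_inv_last]
          exact hx ▸ ih
      · refine .step ?_ ?_
        · rw [swapLast_inv_castSucc, if_neg hx]
          exact h
        · rw [swapLast_inv_castSucc, if_neg hx]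
          exact ih
  exact bCode_eq_of_firstBelow (key (firstBelow_bCode τ a))

theorem cyc_swapLast (τ : Equiv.Perm (Fin n)) (i : Fin (n + 1)) :
    cyc (swapLast τ i) = cyc τ + if i = Fin.last n then 1 else 0 := by
  rw [cyc_eq_card_bCode, cyc_eq_card_bCode, Finset.card_filter, Finset.card_filter,
    Fin.sum_univ_castSucc]
  simp only [bCode_swapLast_castSucc, bCode_swapLast_last, Fin.castSucc_inj]

theorem lmic₁_swapLast (τ : Equiv.Perm (Fin n)) (i : Fin (n + 1)) :
    lmic₁ (swapLast τ i) = lmic₁ τ + if i = 0 then 1 else 0 := by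
  rw [lmic₁, lmic₁, Finset.card_filter, Finset.card_filter, Fin.sum_univ_castSucc]
  simp only [bCode_swapLast_castSucc, bCode_swapLast_last, Fin.val_castSucc, Fin.val_eq_zero_iff]

/-! ### The sorting index under the same construction. -/

theorem sor_eq {σ : Equiv.Perm (Fin n)} {l : List (Fin n × Fin n)}
    (h : IsSortingDecomposition σ l) :
    sor σ = (l.map fun p => (p.2 : ℕ) - (p.1 : ℕ)).sum := by
  rw [sor, (existsUnique_sortingDecomposition σ).choose_spec.2 l h]

/-- Adjoining a fixed largest letter is multiplicative, so it transports sorting decompositions. -/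
theorem insertLast_last_mul (σ τ : Equiv.Perm (Fin n)) :
    insertLast (σ * τ) (Fin.last n) =
      insertLast σ (Fin.last n) * insertLast τ (Fin.last n) := by
  refine Equiv.ext fun i => ?_
  induction i using Fin.lastCases with
  | last => simp
  | cast j => simp

theorem insertLast_last_swap (i j : Fin n) :
    insertLast (Equiv.swap i j) (Fin.last n) = Equiv.swap i.castSucc j.castSucc := by
  refine Equiv.ext fun k => ?_
  induction k using Fin.lastCases with
  | last =>
    rw [insertLast_self, Equiv.swap_apply_of_ne_of_ne (Fin.castSucc_ne_last i).symm
      (Fin.castSucc_ne_last j).symm]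
  | cast k =>
    rw [insertLast_last_castSucc, Equiv.swap_apply_def, Equiv.swap_apply_def]
    simp only [Fin.castSucc_inj]
    split_ifs <;> rfl

theorem insertLast_last_one : insertLast (1 : Equiv.Perm (Fin n)) (Fin.last n) = 1 := by
  refine Equiv.ext fun k => ?_
  induction k using Fin.lastCases with
  | last => simp
  | cast k => simp

theorem IsSortingDecomposition.insertLast_last {τ : Equiv.Perm (Fin n)}
    {l : List (Fin n × Fin n)} (h : IsSortingDecomposition τ l) :
    IsSortingDecomposition (insertLast τ (Fin.last n))
      (l.map fun p => (p.1.castSucc, p.2.castSucc)) := by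
  refine ⟨?_, ?_, ?_⟩
  · simp only [List.mem_map, forall_exists_index, and_imp, forall_apply_eq_imp_iff₂]
    exact fun p hp => h.fst_lt_snd p hp
  · exact List.pairwise_map.2 h.snd_increasing
  · rw [← h.prod_eq]
    clear h
    induction l with
    | nil => simp [insertLast_last_one]
    | cons p l ih =>
      rw [List.map_cons, List.map_cons, List.prod_cons, ih, List.map_cons, List.prod_cons,
        insertLast_last_mul, insertLast_last_swap]

/-- Unless `i` is the last place, the decomposition of `τ` is extended at its end by the
transposition of `i` and the largest letter. -/
theorem sor_swapLast (τ : Equiv.Perm (Fin n)) (i : Fin (n + 1)) :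
    sor (swapLast τ i) = sor τ + (n - i) := by
  obtain ⟨l, hl, -⟩ := existsUnique_sortingDecomposition τ
  have hl' := hl.insertLast_last
  rw [sor_eq hl]
  by_cases hi : i = Fin.last n
  · have e : swapLast τ i = insertLast τ (Fin.last n) := by
      rw [swapLast, hi, Equiv.swap_self, ← Equiv.Perm.one_def, mul_one]
    rw [e, sor_eq hl', List.map_map, hi]
    simp [Function.comp_def]
  · have hlt : i < Fin.last n := lt_of_le_of_ne (Fin.le_last i) hi
    have h : IsSortingDecomposition (swapLast τ i)
        ((l.map fun p => (p.1.castSucc, p.2.castSucc)) ++ [(i, Fin.last n)]) := by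
      refine ⟨?_, ?_, ?_⟩
      · intro p hp
        rcases List.mem_append.1 hp with hp | hp
        · exact hl'.fst_lt_snd p hp
        · rw [List.mem_singleton.1 hp]
          exact hlt
      · refine List.pairwise_append.2 ⟨hl'.snd_increasing, by simp, fun p hp q hq => ?_⟩
        rw [List.mem_singleton.1 hq]
        obtain ⟨p, -, rfl⟩ := List.mem_map.1 hp
        exact Fin.castSucc_lt_last _
      · rw [List.map_append, List.prod_append, hl'.prod_eq]
        simp [swapLast]
    rw [sor_eq h, List.map_append, List.sum_append, List.map_map]
    simp [Function.comp_def]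

/-! ### Places of left-to-right maxima and the bijection from `inv` to `sor`. -/

/-- The place `a` carries a left-to-right maximum. -/
def IsLeftMax (σ : Equiv.Perm (Fin n)) (a : Fin n) : Prop := ∀ b, b < a → σ b < σ a

/-- Nothing behind the largest letter is a left-to-right maximum, so only the part of the word
before `i` matters. There both constructions agree with `τ`. -/
theorem isLeftMax_of_apply_eq_last {σ : Equiv.Perm (Fin (n + 1))} {τ : Equiv.Perm (Fin n)}
    {i : Fin (n + 1)} (hi : σ i = Fin.last n)
    (h : ∀ j : Fin n, j.castSucc < i → σ j.castSucc = (τ j).castSucc) (a : Fin (n + 1)) :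
    IsLeftMax σ a ↔ a = i ∨ ∃ j : Fin n, j.castSucc = a ∧ a < i ∧ IsLeftMax τ j := by
  rcases lt_trichotomy a i with ha | rfl | ha
  · obtain ⟨j, rfl⟩ : ∃ j : Fin n, j.castSucc = a :=
      ⟨a.castPred (ha.trans_le (Fin.le_last i)).ne, by simp⟩
    simp only [ha.ne, false_or, Fin.castSucc_inj, exists_eq_left, ha, true_and]
    constructor
    · intro hl k hk
      have := hl k.castSucc hk
      rwa [h j ha, h k ((Fin.castSucc_lt_castSucc_iff.2 hk).trans ha)] at this
    · intro hl b hb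
      obtain ⟨k, rfl⟩ : ∃ k : Fin n, k.castSucc = b :=
        ⟨b.castPred (hb.trans_le (Fin.le_last _)).ne, by simp⟩
      rw [h j ha, h k (hb.trans ha)]
      exact hl k hb
  · simp only [true_or, iff_true]
    intro b hb
    rw [hi]
    exact lt_of_le_of_ne (Fin.le_last _) fun e => hb.ne (σ.injective (e.trans hi.symm))
  · simp only [ha.ne', not_lt_of_gt ha, false_and, and_false, exists_false, or_false, iff_false]
    intro hl
    have := hl i ha
    rw [hi] at this
    exact absurd this (not_lt.2 (Fin.le_last _))

theorem isLeftMax_insertLast (τ : Equiv.Perm (Fin n)) (i a : Fin (n + 1)) :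
    IsLeftMax (insertLast τ i) a ↔
      a = i ∨ ∃ j : Fin n, j.castSucc = a ∧ a < i ∧ IsLeftMax τ j :=
  isLeftMax_of_apply_eq_last (insertLast_self τ i)
    (fun j hj => by rw [← Fin.succAbove_of_castSucc_lt i j hj, insertLast_succAbove]) a

theorem isLeftMax_swapLast (τ : Equiv.Perm (Fin n)) (i a : Fin (n + 1)) :
    IsLeftMax (swapLast τ i) a ↔
      a = i ∨ ∃ j : Fin n, j.castSucc = a ∧ a < i ∧ IsLeftMax τ j :=
  isLeftMax_of_apply_eq_last (swapLast_self τ i) (fun _ hj => swapLast_castSucc τ hj.ne) a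

/-- The induction carries the places of the left-to-right maxima, not just their number: how many
survive an insertion depends on how many lie before `i`. -/
theorem exists_equiv_sor_isLeftMax (n : ℕ) :
    ∃ e : Equiv.Perm (Fin n) ≃ Equiv.Perm (Fin n), ∀ σ,
      sor (e σ) = inv σ ∧ cyc (e σ) = rmin σ ∧ lmic₁ (e σ) = lmin σ ∧
        ∀ a, IsLeftMax (e σ) a ↔ IsLeftMax σ a := by
  induction n with
  | zero =>
    refine ⟨Equiv.refl _, fun σ => ⟨?_, ?_, ?_, fun a => Iff.rfl⟩⟩
    · have : IsSortingDecomposition σ [] := ⟨by simp, by simp, Subsingleton.elim _ _⟩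
      rw [Equiv.refl_apply, sor_eq this]
      simp [inv]
    · simp [cyc_eq_card_bCode, rmin]
    · simp [lmic₁, lmin]
  | succ n ih =>
    obtain ⟨e, he⟩ := ih
    -- Remove the largest letter, apply `e` to the rest, and rebuild by `swapLast` with the same
    -- `i`.
    refine ⟨((Equiv.ofBijective _ insertLast_bijective).symm.trans
      (e.prodCongr (Equiv.refl _))).trans (Equiv.ofBijective _ swapLast_bijective), fun σ => ?_⟩
    obtain ⟨⟨τ, i⟩, rfl⟩ := insertLast_bijective.2 σ
    have h := (Equiv.ofBijective _ (insertLast_bijective (n := n))).symm_apply_apply (τ, i)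
    rw [Equiv.ofBijective_apply] at h
    simp only [Equiv.trans_apply, h, Equiv.prodCongr_apply, Prod.map_apply, Equiv.refl_apply,
      Equiv.ofBijective_apply]
    obtain ⟨h1, h2, h3, h4⟩ := he τ
    refine ⟨?_, ?_, ?_, fun a => ?_⟩
    · rw [sor_swapLast, inv_insertLast, h1]
    · rw [cyc_swapLast, rmin_insertLast, h2]
    · rw [lmic₁_swapLast, lmin_insertLast, h3]
    · simp only [isLeftMax_swapLast, isLeftMax_insertLast, h4]

theorem exists_equiv_sor :
    ∃ e : Equiv.Perm (Fin n) ≃ Equiv.Perm (Fin n), ∀ σ,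
      sor (e σ) = inv σ ∧ cyc (e σ) = rmin σ ∧ lmic₁ (e σ) = lmin σ ∧ lmax (e σ) = lmax σ := by
  obtain ⟨e, he⟩ := exists_equiv_sor_isLeftMax n
  refine ⟨e, fun σ => ⟨(he σ).1, (he σ).2.1, (he σ).2.2.1, ?_⟩⟩
  unfold lmax
  congr 1
  ext a
  rw [mem_filter_univ, mem_filter_univ]
  exact (he σ).2.2.2 a

/-! ### Foata's transformation on words. -/

section Words

variable {α : Type*}

/-- Shifts the letters of `p :: l` satisfying `P` (the first letter `p` is supposed to do so):
each of them moves to the right, past all letters before the next letter that satisfies `P`. -/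
def shiftRight (P : α → Prop) [DecidablePred P] : α → List α → List α
  | p, [] => [p]
  | p, x :: l => if P x then p :: shiftRight P x l else x :: shiftRight P p l

variable (P : α → Prop) [DecidablePred P]

theorem shiftRight_perm (p : α) (l : List α) : (shiftRight P p l).Perm (p :: l) := by
  induction l generalizing p with
  | nil => exact .refl _
  | cons x l ih =>
    rw [shiftRight]
    split_ifs
    · exact (ih x).cons p
    · exact ((ih p).cons x).trans (.swap _ _ _)

theorem filter_shiftRight {p : α} (hp : P p) (l : List α) :
    (shiftRight P p l).filter P = (p :: l).filter P := by
  induction l generalizing p with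
  | nil => rfl
  | cons x l ih =>
    rw [shiftRight]
    split_ifs with hx
    · simp [ih hx, hp]
    · simp [ih hp, hp, hx]

theorem filter_not_shiftRight {p : α} (hp : P p) (l : List α) :
    (shiftRight P p l).filter (¬ P ·) = (p :: l).filter (¬ P ·) := by
  induction l generalizing p with
  | nil => rfl
  | cons x l ih =>
    rw [shiftRight]
    split_ifs with hx
    · rw [List.filter_cons_of_neg (by simpa using hp), ih hx,
        List.filter_cons_of_neg (a := p) (by simpa using hp)]
    · rw [List.filter_cons_of_pos (by simpa using hx), ih hp,
        List.filter_cons_of_neg (by simpa using hp), List.filter_cons_of_neg (by simpa using hp),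
        List.filter_cons_of_pos (by simpa using hx)]

/-- The last letter of the result reveals which predicate was used; this makes the Foata step
invertible. -/
theorem exists_shiftRight_eq_concat {p : α} (hp : P p) (l : List α) :
    ∃ k z, P z ∧ shiftRight P p l = k ++ [z] := by
  induction l generalizing p with
  | nil => exact ⟨[], p, hp, rfl⟩
  | cons x l ih =>
    rw [shiftRight]
    split_ifs with hx
    · obtain ⟨k, z, hz, e⟩ := ih hx
      exact ⟨p :: k, z, hz, by simp [e]⟩
    · obtain ⟨k, z, hz, e⟩ := ih hp
      exact ⟨x :: k, z, hz, by simp [e]⟩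

theorem shiftRight_inj {p p' : α} (hp : P p) (hp' : P p') {l l' : List α}
    (h : shiftRight P p l = shiftRight P p' l') : p :: l = p' :: l' := by
  have hlen : l.length = l'.length := by
    have := (shiftRight_perm P p l).length_eq
    rw [h, (shiftRight_perm P p' l').length_eq] at this
    simpa using this.symm
  induction l generalizing p p' l' with
  | nil =>
    obtain rfl : l' = [] := List.eq_nil_of_length_eq_zero hlen.symm
    exact h
  | cons x l ih =>
    obtain _ | ⟨x', l'⟩ := l'
    · simp at hlen
    have hlen' : l.length = l'.length := by simpa using hlen
    rw [shiftRight, shiftRight] at h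
    split_ifs at h with hx hx' hx'
    all_goals obtain ⟨h1, h2⟩ := List.cons.inj h
    · rw [h1, ih hx hx' h2 hlen']
    · exact absurd (h1 ▸ hp) hx'
    · exact absurd (h1 ▸ hp') hx
    · obtain ⟨rfl, rfl⟩ := List.cons.inj (ih hp hp' h2 hlen')
      rw [h1]

/-- The number of left-to-right records of a word with respect to `r` among the letters that are
`r`-related to `t`. -/
def wordRecords (r : α → α → Prop) [DecidableRel r] : α → List α → ℕ
  | _, [] => 0
  | t, a :: l => if r a t then wordRecords r a l + 1 else wordRecords r t l

theorem wordRecords_filter (r : α → α → Prop) [DecidableRel r] [IsTrans α r] (t : α)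
    (l : List α) : wordRecords r t (l.filter (r · t)) = wordRecords r t l := by
  -- The threshold `t` changes at each record while the filter stays put, so the induction must
  -- separate the two.
  have key : ∀ s, (∀ x, r x t → r x s) → ∀ l : List α,
      wordRecords r t (l.filter (r · s)) = wordRecords r t l := by
    intro s hs l
    induction l generalizing t with
    | nil => rfl
    | cons a l ih =>
      by_cases ha : r a t
      · rw [List.filter_cons_of_pos (by simpa using hs a ha), wordRecords, wordRecords,
          if_pos ha, if_pos ha, ih a fun x hx => hs x (_root_.trans hx ha)]
      · rw [wordRecords, if_neg ha]
        by_cases has : r a s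
        · rw [List.filter_cons_of_pos (by simpa using has), wordRecords, if_neg ha, ih t hs]
        · rw [List.filter_cons_of_neg (by simpa using has), ih t hs]
  exact key t (fun _ => id) l

theorem wordRecords_ofFn (r : α → α → Prop) [DecidableRel r] [IsStrictTotalOrder α r] {n : ℕ}
    (f : Fin n → α) (t : α) :
    wordRecords r t (List.ofFn f) = #{i : Fin n | r (f i) t ∧ ∀ j, j < i → r (f i) (f j)} := by
  induction n generalizing t with
  | zero => simp [wordRecords]
  | succ n ih =>
    rw [List.ofFn_succ, wordRecords, Finset.card_filter, Fin.sum_univ_succ]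
    simp only [ih, Finset.card_filter, Fin.forall_fin_succ, Fin.succ_pos, Fin.succ_lt_succ_iff,
      Fin.not_lt_zero, false_imp_iff, true_imp_iff, and_true, implies_true]
    split_ifs with h
    · rw [add_comm]
      congr 1
      refine Finset.sum_congr rfl fun i _ => ?_
      congr 1
      simp only [eq_iff_iff]
      exact ⟨fun h' => ⟨_root_.trans h'.1 h, h'⟩, fun h' => h'.2⟩
    · rw [zero_add]
      refine Finset.sum_congr rfl fun i _ => ?_
      congr 1
      simp only [eq_iff_iff]
      refine ⟨fun h' => ⟨h'.1, ?_, h'.2⟩, fun h' => ⟨h'.1, h'.2.2⟩⟩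
      rcases trichotomous_of r (f 0) t with h0 | h0 | h0
      · exact absurd h0 h
      · exact h0 ▸ h'.1
      · exact _root_.trans h'.1 h0

variable [LinearOrder α]

/-- The number of inversions of a word. -/
def wordInv : List α → ℕ
  | [] => 0
  | a :: l => l.countP (· < a) + wordInv l

/-- The sum, over the descents of a word, of the number of letters behind the descent. -/
def wordCharge : List α → ℕ
  | [] => 0
  | [_] => 0
  | a :: b :: l => (if b < a then l.length + 1 else 0) + wordCharge (b :: l)

/-- Each letter not below `a` is passed by exactly one smaller letter, the nearest one below `a` in
front of it, and this creates one inversion. -/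
theorem wordInv_shiftRight_lt {a p : α} (hp : p < a) (l : List α) :
    wordInv (shiftRight (· < a) p l) = wordInv (p :: l) + l.countP (¬ · < a) := by
  induction l generalizing p with
  | nil => rfl
  | cons x l ih =>
    rw [shiftRight]
    split_ifs with hx
    · rw [wordInv, ih hx, (shiftRight_perm _ x l).countP_eq, wordInv, wordInv,
        wordInv, List.countP_cons_of_neg (p := fun y => decide (¬ y < a)) (by simpa using hx)]
      ring
    · have hpx : p < x := hp.trans_le (not_lt.1 hx)
      rw [wordInv, ih hp, (shiftRight_perm _ p l).countP_eq, wordInv, wordInv, wordInv,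
        List.countP_cons_of_pos (p := fun y => decide (¬ y < a)) (by simpa using hx),
        List.countP_cons_of_pos (by simpa using hpx),
        List.countP_cons_of_neg (by simpa using hpx.le)]
      ring

theorem wordInv_shiftRight_gt {a p : α} (hp : a < p) (l : List α) :
    wordInv (shiftRight (a < ·) p l) + l.countP (¬ a < ·) = wordInv (p :: l) := by
  induction l generalizing p with
  | nil => rfl
  | cons x l ih =>
    rw [shiftRight]
    split_ifs with hx
    · rw [List.countP_cons_of_neg (by simpa using hx), wordInv, wordInv, add_assoc, ih hx,
        (shiftRight_perm _ x l).countP_eq]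
    · have hpx : x < p := (not_lt.1 hx).trans_lt hp
      have := ih hp
      rw [List.countP_cons_of_pos (by simpa using hx), wordInv, wordInv, wordInv,
        (shiftRight_perm _ p l).countP_eq,
        List.countP_cons_of_pos (p := fun y => decide (y < p)) (by simpa using hpx),
        List.countP_cons_of_neg (by simpa using hpx.le)]
      rw [wordInv] at this
      omega

/-- The step of Foata's bijection that rearranges a word before the letter `a` is put in front. -/
def foataStep (a : α) : List α → List α
  | [] => []
  | b :: l => if b < a then shiftRight (· < a) b l else shiftRight (a < ·) b l

/-- Foata's second fundamental transformation (read from right to left). -/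
def foata : List α → List α
  | [] => []
  | a :: l => a :: foataStep a (foata l)

theorem foataStep_perm (a : α) (l : List α) : (foataStep a l).Perm l := by
  cases l with
  | nil => exact .refl _
  | cons b l =>
    rw [foataStep]
    split_ifs
    · exact shiftRight_perm _ _ _
    · exact shiftRight_perm _ _ _

theorem foata_perm (l : List α) : (foata l).Perm l := by
  induction l with
  | nil => exact .refl _
  | cons a l ih => exact ((foataStep_perm a _).trans ih).cons a

/-- A shift keeps the order among the moved letters and among the passed ones; as `a` is absent, the
letters below `a` form one of these two classes. -/
theorem filter_lt_foataStep {a : α} {l : List α} (ha : a ∉ l) :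
    (foataStep a l).filter (· < a) = l.filter (· < a) := by
  cases l with
  | nil => rfl
  | cons b l =>
    have hb : b ≠ a := fun e => ha (by simp [e])
    rw [foataStep]
    split_ifs with h
    · exact filter_shiftRight (· < a) h l
    · have h' : a < b := lt_of_le_of_ne (not_lt.1 h) hb.symm
      have e : ∀ k : List α, a ∉ k → k.filter (· < a) = k.filter (¬ a < ·) := by
        intro k hk
        refine List.filter_congr fun x hx => ?_
        have : x ≠ a := fun e => hk (e ▸ hx)
        exact decide_eq_decide.2 ⟨lt_asymm, fun h => lt_of_le_of_ne (not_lt.1 h) this⟩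
      rw [e _ ha, e _ fun h => ha ((shiftRight_perm _ _ _).mem_iff.1 h)]
      exact filter_not_shiftRight (a < ·) h' l

theorem filter_gt_foataStep {a : α} {l : List α} (ha : a ∉ l) :
    (foataStep a l).filter (· > a) = l.filter (· > a) := by
  cases l with
  | nil => rfl
  | cons b l =>
    have hb : b ≠ a := fun e => ha (by simp [e])
    rw [foataStep]
    split_ifs with h
    · have e : ∀ k : List α, a ∉ k → k.filter (· > a) = k.filter (¬ · < a) := by
        intro k hk
        refine List.filter_congr fun x hx => ?_
        have : a ≠ x := fun e => hk (e ▸ hx)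
        exact decide_eq_decide.2 ⟨lt_asymm, fun h => lt_of_le_of_ne (not_lt.1 h) this⟩
      rw [e _ ha, e _ fun h => ha ((shiftRight_perm _ _ _).mem_iff.1 h)]
      exact filter_not_shiftRight (· < a) h l
    · exact filter_shiftRight (a < ·) (lt_of_le_of_ne (not_lt.1 h) hb.symm) l

theorem wordRecords_foata (r : α → α → Prop) [DecidableRel r] [IsStrictTotalOrder α r]
    (hr : ∀ (a : α) (l : List α), a ∉ l →
      (foataStep a l).filter (r · a) = l.filter (r · a))
    {l : List α} (hl : l.Nodup) (t : α) :
    wordRecords r t (foata l) = wordRecords r t l := by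
  induction l generalizing t with
  | nil => rfl
  | cons a l ih =>
    obtain ⟨ha, hl'⟩ := List.nodup_cons.1 hl
    have ha' : a ∉ foata l := fun h => ha ((foata_perm l).mem_iff.1 h)
    rw [foata, wordRecords, wordRecords]
    split_ifs with h
    · rw [← wordRecords_filter, hr a _ ha', wordRecords_filter, ih hl']
    -- Here `a` is no record, so every letter that beats `t` also beats `a`, and the Foata step
    -- keeps the order of those letters.
    · have e : ∀ k : List α, k.filter (r · t) = (k.filter (r · a)).filter (r · t) := by
        intro k
        rw [List.filter_filter]
        refine List.filter_congr fun x _ => ?_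
        rcases trichotomous_of r a t with h' | h' | h'
        · exact absurd h' h
        · simp [h']
        · by_cases hx : r x t
          · simp [hx, _root_.trans hx h']
          · simp [hx]
      rw [← wordRecords_filter, e, hr a _ ha', ← e, wordRecords_filter, ih hl']

/-- Putting `a` in front adds one inversion per smaller letter. If `b < a`, the shift adds one per
larger letter, in total the number of letters behind `a`; otherwise it removes as many as were
added. The first letter is never changed by `foata`, so the case is decided by the original word. -/
theorem wordInv_foata {l : List α} (hl : l.Nodup) : wordInv (foata l) = wordCharge l := by
  induction l with
  | nil => rfl
  | cons a l ih =>
    obtain ⟨ha, hl'⟩ := List.nodup_cons.1 hl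
    obtain _ | ⟨b, l⟩ := l
    · rfl
    have hb : b ≠ a := fun e => ha (by simp [e])
    rw [wordCharge, ← ih hl', foata, wordInv, (foataStep_perm _ _).countP_eq]
    have hlen := (foata_perm (b :: l)).length_eq
    have hmem : a ∉ foata (b :: l) := fun h => ha ((foata_perm _).mem_iff.1 h)
    rw [foata] at hlen hmem ⊢
    generalize foataStep b (foata l) = k at hlen hmem ⊢
    have hlen' : k.length = l.length := by simpa using hlen
    rw [foataStep]
    split_ifs with h
    · rw [wordInv_shiftRight_lt h, List.countP_cons_of_pos (by simpa using h)]
      have := List.length_eq_countP_add_countP (fun x => decide (x < a)) (l := k)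
      simp only [decide_eq_true_eq] at this ⊢
      omega
    · have h' : a < b := lt_of_le_of_ne (not_lt.1 h) hb.symm
      rw [← wordInv_shiftRight_gt h', List.countP_cons_of_neg (by simpa using h)]
      have : k.countP (· < a) = k.countP (¬ a < ·) := by
        refine List.countP_congr fun x hx => ?_
        have : x ≠ a := fun e => hmem (by simp [← e, hx])
        rw [decide_eq_true_iff, decide_eq_true_iff]
        exact ⟨lt_asymm, fun h => lt_of_le_of_ne (not_lt.1 h) this⟩
      omega

theorem foataStep_inj {a : α} {l l' : List α} (ha : a ∉ l) (ha' : a ∉ l')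
    (h : foataStep a l = foataStep a l') : l = l' := by
  have hlen : l.length = l'.length := by
    rw [← (foataStep_perm a l).length_eq, h, (foataStep_perm a l').length_eq]
  obtain _ | ⟨b, l⟩ := l <;> obtain _ | ⟨b', l'⟩ := l'
  · rfl
  · simp at hlen
  · simp at hlen
  have hb : b ≠ a := fun e => ha (by simp [e])
  have hb' : b' ≠ a := fun e => ha' (by simp [e])
  rw [foataStep, foataStep] at h
  have gt : ∀ {x}, x ≠ a → ¬ x < a → a < x := fun hx h => lt_of_le_of_ne (not_lt.1 h) hx.symm
  have conflict : ∀ {x y k k'}, x < a → a < y →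
      shiftRight (· < a) x k ≠ shiftRight (a < ·) y k' := by
    intro x y k k' hx hy e
    obtain ⟨m, z, hz, e1⟩ := exists_shiftRight_eq_concat (· < a) hx k
    obtain ⟨m', z', hz', e2⟩ := exists_shiftRight_eq_concat (a < ·) hy k'
    rw [e1, e2] at e
    have := (List.append_inj' e rfl).2
    simp only [List.cons.injEq, and_true] at this
    exact lt_asymm (this ▸ hz) hz'
  split_ifs at h with h1 h2 h2
  · exact shiftRight_inj (· < a) h1 h2 h
  · exact absurd h (conflict h1 (gt hb' h2))
  · exact absurd h.symm (conflict h2 (gt hb h1))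
  · exact shiftRight_inj (a < ·) (gt hb h1) (gt hb' h2) h

theorem foata_inj {l l' : List α} (hl : l.Nodup) (hl' : l'.Nodup) (h : foata l = foata l') :
    l = l' := by
  induction l generalizing l' with
  | nil =>
    cases l' with
    | nil => rfl
    | cons a l' => simp [foata] at h
  | cons a l ih =>
    cases l' with
    | nil => simp [foata] at h
    | cons a' l' =>
      obtain ⟨rfl, h2⟩ := List.cons.inj h
      obtain ⟨ha, hl⟩ := List.nodup_cons.1 hl
      obtain ⟨ha', hl'⟩ := List.nodup_cons.1 hl'
      rw [ih hl hl' (foataStep_inj (fun h => ha ((foata_perm l).mem_iff.1 h))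
        (fun h => ha' ((foata_perm l').mem_iff.1 h)) h2)]

theorem wordInv_ofFn {n : ℕ} (f : Fin n → α) :
    wordInv (List.ofFn f) = #{p : Fin n × Fin n | p.1 < p.2 ∧ f p.2 < f p.1} := by
  induction n with
  | zero => simp [wordInv]
  | succ n ih =>
    rw [List.ofFn_succ, wordInv, ih, Finset.card_filter, Finset.card_filter,
      Fintype.sum_prod_type, Fintype.sum_prod_type, Fin.sum_univ_succ]
    congr 1
    · rw [Fin.sum_univ_succ]
      simp only [lt_self_iff_false, false_and, if_false, Fin.succ_pos, true_and, zero_add]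
      rw [List.ofFn_eq_map, List.countP_map, ← Finset.card_filter]
      rw [List.countP_eq_length_filter, ← List.toFinset_card_of_nodup
        ((List.nodup_finRange n).filter _)]
      congr 1
      ext i
      simp
    · refine Finset.sum_congr rfl fun a _ => ?_
      rw [Fin.sum_univ_succ]
      simp

theorem wordCharge_ofFn {n : ℕ} (f : Fin n → α) :
    wordCharge (List.ofFn f) =
      ∑ i : Fin n, if ∃ h : (i : ℕ) + 1 < n, f ⟨i + 1, h⟩ < f i then n - ((i : ℕ) + 1) else 0 := by
  induction n with
  | zero => simp [wordCharge]
  | succ n ih =>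
    obtain _ | n := n
    · rw [List.ofFn_succ, List.ofFn_zero, wordCharge, Fin.sum_univ_one,
        if_neg fun ⟨h, _⟩ => absurd h (by simp)]
    rw [List.ofFn_succ, List.ofFn_succ, wordCharge, ← List.ofFn_succ (f := fun i => f i.succ), ih,
      Fin.sum_univ_succ (n := n + 1)]
    congr 1
    · simp
    · refine Finset.sum_congr rfl fun i _ => ?_
      simp only [Fin.val_succ, Nat.add_lt_add_iff_right, Nat.add_sub_add_right]
      rfl

end Words

/-! ### Back from words to permutations. -/

/-- The word of a permutation, with integer letters. -/
def word (σ : Equiv.Perm (Fin n)) : List ℤ := List.ofFn fun i => ((σ i : ℕ) : ℤ)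

theorem word_nodup (σ : Equiv.Perm (Fin n)) : (word σ).Nodup :=
  List.nodup_ofFn.2 fun i j h => σ.injective (Fin.ext (by simpa using h))

theorem word_injective : Function.Injective (word (n := n)) := by
  intro σ τ h
  ext i
  have := congrFun (List.ofFn_injective h) i
  simpa using this

theorem exists_word_eq (σ : Equiv.Perm (Fin n)) {l : List ℤ} (hl : l.Perm (word σ)) :
    ∃ τ : Equiv.Perm (Fin n), word τ = l := by
  have hlen : l.length = n := by rw [hl.length_eq, word, List.length_ofFn]
  subst hlen
  have hmem : ∀ i : Fin l.length, ∃ a : Fin l.length, ((a : ℕ) : ℤ) = l.get i := fun i => by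
    have : l.get i ∈ word σ := hl.mem_iff.1 (List.get_mem l i)
    obtain ⟨j, hj⟩ := List.mem_ofFn.1 this
    exact ⟨σ j, hj⟩
  choose f hf using hmem
  have hinj : Function.Injective f := fun i j h => by
    have h' : l.get i = l.get j := by rw [← hf, ← hf, h]
    exact List.nodup_iff_injective_get.1 (hl.nodup_iff.2 (word_nodup σ)) h'
  refine ⟨Equiv.ofBijective f (Finite.injective_iff_bijective.1 hinj), ?_⟩
  simp only [word, Equiv.ofBijective_apply, hf]
  exact List.ofFn_get l

theorem wordInv_word (σ : Equiv.Perm (Fin n)) : wordInv (word σ) = inv σ := by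
  rw [word, wordInv_ofFn]
  simp [inv]

theorem wordCharge_word (σ : Equiv.Perm (Fin n)) : wordCharge (word σ) = chg σ⁻¹ := by
  rw [word, wordCharge_ofFn, chg_inv, desSet, Finset.sum_filter]
  simp

/-- The threshold `n` exceeds all letters and so excludes none; integer letters also allow `-1` for
the maxima. -/
theorem wordRecords_lt_word (σ : Equiv.Perm (Fin n)) :
    wordRecords (· < ·) (n : ℤ) (word σ) = lmin σ := by
  rw [word, wordRecords_ofFn]
  simp [lmin]

theorem wordRecords_gt_word (σ : Equiv.Perm (Fin n)) :
    wordRecords (· > ·) (-1 : ℤ) (word σ) = lmax σ := by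
  rw [word, wordRecords_ofFn]
  have : ∀ k : ℕ, (-1 : ℤ) < k := fun k => by omega
  simp [lmax, this]

theorem exists_equiv_chg :
    ∃ e : Equiv.Perm (Fin n) ≃ Equiv.Perm (Fin n), ∀ σ,
      chg (e σ)⁻¹ = inv σ ∧ lmax (e σ) = lmax σ ∧ lmin (e σ) = lmin σ := by
  choose f hf using fun σ : Equiv.Perm (Fin n) => exists_word_eq σ (foata_perm (word σ))
  have hinj : Function.Injective f := fun σ τ h =>
    word_injective (foata_inj (word_nodup σ) (word_nodup τ) (by rw [← hf, ← hf, h]))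
  have key : ∀ σ, inv (f σ) = chg σ⁻¹ ∧ lmax (f σ) = lmax σ ∧ lmin (f σ) = lmin σ := by
    refine fun σ => ⟨?_, ?_, ?_⟩
    · rw [← wordInv_word, hf, wordInv_foata (word_nodup σ), wordCharge_word]
    · rw [← wordRecords_gt_word, hf,
        wordRecords_foata _ (fun a l h => filter_gt_foataStep h) (word_nodup σ),
        wordRecords_gt_word]
    · rw [← wordRecords_lt_word, hf,
        wordRecords_foata _ (fun a l h => filter_lt_foataStep h) (word_nodup σ),
        wordRecords_lt_word]
  let e := Equiv.ofBijective f (Finite.injective_iff_bijective.1 hinj)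
  refine ⟨e.symm, fun σ => ?_⟩
  have h := key (e.symm σ)
  rw [show f (e.symm σ) = σ from e.apply_symm_apply σ] at h
  exact ⟨h.1.symm, h.2.1.symm, h.2.2.symm⟩

/-! ### Assembling the bijections. -/

/-- The statistics `(inv, rmin, lmin, lmax)`. -/
def baseStat : Fin 4 → Stat n := ![inv, rmin, lmin, lmax]

/-- Some bijection of the symmetric group carries `(inv, rmin, lmin, lmax)` to the entries of `Q`
that are not omitted. -/
def Realizes (Q : Quadruple n) : Prop :=
  ∃ e : Equiv.Perm (Fin n) ≃ Equiv.Perm (Fin n), ∀ i, ∀ s ∈ Q i, ∀ σ, s (e σ) = baseStat i σ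

theorem Realizes.jointlyEquidistributed {Q Q' : Quadruple n} (h : Realizes Q)
    (h' : Realizes Q') : JointlyEquidistributed Q Q' := by
  obtain ⟨e, he⟩ := h
  obtain ⟨e', he'⟩ := h'
  intro v
  refine Nat.card_congr ((e.symm.trans e').subtypeEquiv fun σ => ?_)
  refine forall_congr' fun i => ?_
  rw [Equiv.trans_apply]
  obtain ⟨τ, rfl⟩ := e.surjective σ
  rw [e.symm_apply_apply]
  constructor
  · intro h s hs s' hs'
    rw [he' i s' hs', ← he i s hs]
    exact h s hs s' hs'
  · intro h s hs s' hs'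
    rw [he i s hs, ← he' i s' hs']
    exact h s hs s' hs'

/-- Setting the variable of an omitted entry to `1` makes the corresponding base statistic
weightless. -/
theorem Realizes.genFun_eq {Q : Quadruple (n + 1)} (h : Realizes Q) :
    genFun Q = F (n + 1) (variableOf (Q 0) (MvPolynomial.X 0))
      (variableOf (Q 1) (MvPolynomial.X 1)) (variableOf (Q 2) (MvPolynomial.X 2)) := by
  obtain ⟨e, he⟩ := h
  have key : ∀ (i : Fin 4) (t : MvPolynomial (Fin 3) ℤ) (σ : Equiv.Perm (Fin (n + 1))),
      weight (Q i) t (e σ) = variableOf (Q i) t ^ baseStat i σ := by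
    intro i t σ
    have := he i
    cases hQ : Q i with
    | none => simp [weight, variableOf]
    | some s => simp [weight, variableOf, this s hQ]
  rw [genFun, ← e.sum_comp, ← sum_inv_rmin_lmin]
  refine Finset.sum_congr rfl fun σ _ => ?_
  rw [key, key, key]
  rfl

theorem realizes_quadruple (n : ℕ) (a : Fin 21) : Realizes (quadruple n a) := by
  obtain ⟨f, hf⟩ := exists_equiv_sor (n := n)
  obtain ⟨g, hg⟩ := exists_equiv_chg (n := n)
  have sor_f := fun σ => (hf σ).1
  have cyc_f := fun σ => (hf σ).2.1
  have lmic_f := fun σ => (hf σ).2.2.1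
  have lmax_f := fun σ => (hf σ).2.2.2
  have cosor_f : ∀ σ, cosor (f σ) = coinv σ := fun σ => by rw [cosor, coinv, sor_f]
  have chg_g := fun σ => (hg σ).1
  have lmax_g := fun σ => (hg σ).2.1
  have lmin_g := fun σ => (hg σ).2.2
  let I : Equiv.Perm (Fin n) ≃ Equiv.Perm (Fin n) := Equiv.inv _
  let R : Equiv.Perm (Fin n) ≃ Equiv.Perm (Fin n) := reverseEquiv
  let C : Equiv.Perm (Fin n) ≃ Equiv.Perm (Fin n) := complementEquiv
  -- Composites act from left to right. Those with `f` serve `sor` and `cyc`, those with `g` the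
  -- statistics of major-index type; the symmetry rules verify each entry.
  let e : Fin 21 → (Equiv.Perm (Fin n) ≃ Equiv.Perm (Fin n)) :=
    ![Equiv.refl _, f, I, I.trans (C.trans R), C.trans R, R, C, I.trans R, I.trans C,
      I.trans f, R.trans f, C.trans f, (I.trans R).trans f, (I.trans C).trans f,
      f.trans (C.trans R), (I.trans f).trans (C.trans R), (I.trans g).trans (C.trans R),
      ((I.trans g).trans (C.trans R)).trans I, I.trans g, (I.trans g).trans I,
      ((I.trans g).trans I).trans R]
  refine ⟨e a, ?_⟩
  fin_cases a <;> intro i <;> fin_cases i <;>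
    simp [quadruple, baseStat, e, I, R, C, sor_f, cyc_f, lmic_f, lmax_f, cosor_f, chg_g, lmax_g,
      lmin_g, imaj]

end PermStat

theorem theorem5p2 (n : ℕ) (hn : 1 ≤ n) :
    (∀ a b : Fin 21,
      PermStat.JointlyEquidistributed (PermStat.quadruple n a) (PermStat.quadruple n b)) ∧
    (∀ a : Fin 21,
      PermStat.genFun (PermStat.quadruple n a) =
        PermStat.F n
          (PermStat.variableOf (PermStat.quadruple n a 0) (MvPolynomial.X 0))
          (PermStat.variableOf (PermStat.quadruple n a 1) (MvPolynomial.X 1))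
          (PermStat.variableOf (PermStat.quadruple n a 2) (MvPolynomial.X 2))) := by
  obtain ⟨n, rfl⟩ := Nat.exists_eq_add_of_le' hn
  exact ⟨fun a b => (PermStat.realizes_quadruple _ a).jointlyEquidistributed
    (PermStat.realizes_quadruple _ b), fun a => (PermStat.realizes_quadruple _ a).genFun_eq⟩
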